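/- Let $1<p<\infty$ and let $\mathbb{T}$ be the unit circle with normalised Lebesgue measure $d\theta/2\pi$. For $f\in L^p=L^p(\mathbb{T})$ put $\hat f_n=\frac1{2\pi}\int_0^{2\pi} f(e^{i\theta})e^{-in\theta}\,d\theta$, and let $H^p=\{f\in L^p : \hat f_n=0 \text{ for all } n<0\}$ be the Hardy space, with the norm of $L^p$. Let $P$ be the Riesz projection of $L^p$ onto $H^p$, that is, the bounded linear operator on $L^p$ with $\widehat{(Pf)}_n=\hat f_n$ for $n\ge 0$ and $\widehat{(Pf)}_n=0$ for $n<0$, for all $f \in L^p$ (that such an operator exists is part of the assertion), and let $c_p=\|P\|_{B(L^p)}$ be its operator norm. For $a,b\in L^\infty=L^\infty(\mathbb{T})$ (complex-valued) let $T(a)f=P(af)$ and $H(b)f=P(b\,Jf)$, where $(Jf)(t)=\bar t f(\bar t)$ for $t\in\mathbb{T}$; these are bounded linear operators on $H^p$. Then for all $a,b\in L^\infty$ and $A=T(a)+H(b)$, and for every compact linear operator $K$ on $H^p$, $$\max\left\{\|a\|_\infty,\ \frac{1}{1+c_p}\,\|H(b)+K\|\right\}\ \le\ \|A+K\|\ \le\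 c_p\|a\|_\infty+\|H(b)+K\|,$$ where the norms of operators are the operator norms on $H^p$. -/

import Mathlib

open MeasureTheory AddCircle
open scoped ENNReal

namespace HardyToeplitz

noncomputable section

instance instFactTwoPiPos : Fact (0 < 2 * Real.pi) := ⟨Real.two_pi_pos⟩

/-- The unit circle, parametrised by `t = e^{iθ}` with `θ ∈ ℝ / 2πℤ`.  The character `fourier n` is
`χ_n(t) = t ^ n`, and `-θ` corresponds to the complex conjugate of `t`. -/
abbrev 𝕋 : Type := AddCircle (2 * Real.pi)

/-- `L^p` of the unit circle, with respect to the normalised measure `dθ / 2π`. -/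
abbrev LpT (p : ℝ≥0∞) := Lp ℂ p (haarAddCircle : Measure 𝕋)

theorem integrable_LpT {p : ℝ≥0∞} [hp : Fact (1 ≤ p)] (f : LpT p) :
    Integrable (f : 𝕋 → ℂ) haarAddCircle :=
  (Lp.memLp f).integrable hp.out

/-- The Hardy space `H^p = {f ∈ L^p : f̂_n = 0 for n < 0}`, with the norm of `L^p`. -/
def Hp (p : ℝ≥0∞) [Fact (1 ≤ p)] : Submodule ℂ (LpT p) where
  carrier := {f | ∀ n : ℤ, n < 0 → fourierCoeff (f : 𝕋 → ℂ) n = 0}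
  zero_mem' := by
    intro n _
    rw [fourierCoeff_congr_ae (Lp.coeFn_zero ℂ p haarAddCircle)]
    simp [fourierCoeff]
  add_mem' := by
    intro f g hf hg n hn
    rw [fourierCoeff_congr_ae (Lp.coeFn_add f g),
      fourierCoeff.add (integrable_LpT f) (integrable_LpT g), Pi.add_apply, hf n hn, hg n hn,
      add_zero]
  smul_mem' := by
    intro c f hf n hn
    rw [fourierCoeff_congr_ae (Lp.coeFn_smul c f), fourierCoeff.const_smul, hf n hn, smul_zero]

/-- `P` is a bounded operator on `L^p` that acts on Fourier series by
`∑_{n ∈ ℤ} f̂_n χ_n ↦ ∑_{n ≥ 0} f̂_n χ_n`. -/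
def IsRieszProjection {p : ℝ≥0∞} [Fact (1 ≤ p)] (P : LpT p →L[ℂ] LpT p) : Prop :=
  ∀ (f : LpT p) (n : ℤ),
    fourierCoeff (P f : 𝕋 → ℂ) n = if 0 ≤ n then fourierCoeff (f : 𝕋 → ℂ) n else 0

open Classical in
/-- The Riesz projection of `L^p` onto `H^p`: the bounded operator on `L^p` that satisfies
`IsRieszProjection` (the value `0` is taken if there were none). -/
def rieszProjection (p : ℝ≥0∞) [Fact (1 ≤ p)] : LpT p →L[ℂ] LpT p :=
  if h : ∃ P : LpT p →L[ℂ] LpT p, IsRieszProjection P then h.choose else 0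

theorem rieszProjection_mem_Hp {p : ℝ≥0∞} [Fact (1 ≤ p)] (f : LpT p) :
    rieszProjection p f ∈ Hp p := by
  unfold rieszProjection
  split_ifs with h
  · intro n hn
    rw [h.choose_spec f n, if_neg (not_le.mpr hn)]
  · exact (Hp p).zero_mem

/-- The Riesz projection as a map from `L^p` to `H^p`. -/
def rieszToHp (p : ℝ≥0∞) [Fact (1 ≤ p)] : LpT p →L[ℂ] Hp p :=
  (rieszProjection p).codRestrict (Hp p) rieszProjection_mem_Hp

/-- `M(a)`: multiplication by `a ∈ L^∞` on `L^p`. -/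
def mulOp (p : ℝ≥0∞) [Fact (1 ≤ p)] (a : LpT ∞) : LpT p →L[ℂ] LpT p :=
  (ContinuousLinearMap.mul ℂ ℂ).holderL haarAddCircle ∞ p p a

/-- `f(t) ↦ f(t̄)` on `L^p`. -/
def reflOp (p : ℝ≥0∞) [Fact (1 ≤ p)] : LpT p →L[ℂ] LpT p :=
  (Lp.compMeasurePreservingₗᵢ ℂ (fun θ : 𝕋 => -θ)
    (Measure.measurePreserving_neg haarAddCircle)).toContinuousLinearMap

/-- The flip operator `(J f)(t) = t̄ f(t̄)` on `L^p`. -/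
def flipOp (p : ℝ≥0∞) [Fact (1 ≤ p)] : LpT p →L[ℂ] LpT p :=
  mulOp p (fourierLp ∞ (-1)) ∘L reflOp p

/-- The Toeplitz operator `T(a) f = P(a f)` on `H^p`. -/
def toeplitz (p : ℝ≥0∞) [Fact (1 ≤ p)] (a : LpT ∞) : Hp p →L[ℂ] Hp p :=
  rieszToHp p ∘L mulOp p a ∘L (Hp p).subtypeL

/-- The Hankel operator `H(b) f = P(b J f)` on `H^p`. -/
def hankel (p : ℝ≥0∞) [Fact (1 ≤ p)] (b : LpT ∞) : Hp p →L[ℂ] Hp p :=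
  rieszToHp p ∘L mulOp p b ∘L flipOp p ∘L (Hp p).subtypeL

end

end HardyToeplitz

/-! Everything except `‖a‖ ≤ ‖A + K‖` is the triangle inequality together with `‖T(a)‖ ≤ c_p ‖a‖`.
In particular `‖H(b) + K‖ ≤ ‖A + K‖ + c_p ‖a‖`, and the bound on `‖a‖` turns the right side into `(1
+ c_p) ‖A + K‖`.

For the bound on `‖a‖`, fix `f` in `L^p` and test `A + K` on `x_n = P(χ_n f)`. The operators `χ_{-n}
P χ_n` tend strongly to the identity, so `‖x_n‖ → ‖f‖` and `‖T(a) x_n‖ → ‖a f‖`. The flip turns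
`χ_n` into `χ_{-n}`, and `P χ_{-n} → 0` strongly, so `H(b) x_n → 0`. A compact operator sends `χ_n
f` to a null sequence, so `K x_n → 0`. In the limit `‖a f‖ ≤ ‖A + K‖ ‖f‖` for every `f`
(`norm_mulOp_apply_le_of_isCompactOperator`), and indicator functions as `f` give `‖a‖`
(`norm_le_of_norm_mulOp_le`).

The existence of `P` is the theorem of M. Riesz. For `1 < p ≤ 2` a pointwise inequality `|w|^p ≤ A
(Re w)^p - B Re (w^p)` on the right half plane is integrated over the values of a polynomial on the
circle; the mean value property of `Q^p` disposes of the last term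
(`integral_norm_toAddCircle_rpow_le`). Positive and negative parts extend the bound to continuous
functions. The range `p ≥ 2` follows by duality, and density of the characters yields the operator.
-/

namespace HardyToeplitz

open Filter Topology

noncomputable section

/-! ### Uniqueness of Fourier coefficients -/

/-- An integrable function on the circle whose Fourier coefficients all vanish is zero. -/
theorem ae_eq_zero_of_fourierCoeff_eq_zero {f : 𝕋 → ℂ} (hf : Integrable f haarAddCircle)
    (h : ∀ n, fourierCoeff f n = 0) : f =ᵐ[haarAddCircle] 0 := by
  have hint : ∀ g : C(𝕋, ℂ), Integrable (fun t => g t * f t) haarAddCircle := fun g =>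
    hf.bdd_mul (c := ‖g‖) g.continuous.aestronglyMeasurable (.of_forall g.norm_coe_le_norm)
  -- Integration against `f` is a bounded functional on `C(𝕋, ℂ)` that kills the characters, whose
  -- span is dense. Indicators of closed sets are then reached as limits of continuous functions.
  have hcont : ∀ g : C(𝕋, ℂ), ∫ t, g t * f t ∂haarAddCircle = 0 := by
    let φ : C(𝕋, ℂ) →ₗ[ℂ] ℂ :=
      { toFun := fun g => ∫ t, g t * f t ∂haarAddCircle
        map_add' := fun g k => by
          simp only [ContinuousMap.add_apply, add_mul]
          exact integral_add (hint g) (hint k)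
        map_smul' := fun c g => by
          simp only [ContinuousMap.smul_apply, smul_eq_mul, mul_assoc, RingHom.id_apply]
          exact integral_const_mul c _ }
    let Φ : C(𝕋, ℂ) →L[ℂ] ℂ := φ.mkContinuous (∫ t, ‖f t‖ ∂haarAddCircle) fun g => by
      refine (norm_integral_le_integral_norm _).trans ?_
      rw [mul_comm _ ‖g‖, ← integral_const_mul]
      refine integral_mono (hint g).norm (hf.norm.const_mul _) fun t => ?_
      simp only [norm_mul]
      gcongr
      exact g.norm_coe_le_norm t
    have hle : Submodule.span ℂ (Set.range (fourier (T := 2 * Real.pi))) ≤ Φ.toLinearMap.ker := by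
      rw [Submodule.span_le]
      rintro _ ⟨n, rfl⟩
      have := h (-n)
      rw [fourierCoeff, neg_neg] at this
      exact this
    have htop := Submodule.topologicalClosure_minimal _ hle Φ.isClosed_ker
    rw [span_fourier_closure_eq_top, top_le_iff] at htop
    intro g
    exact (htop ▸ Submodule.mem_top : g ∈ Φ.toLinearMap.ker)
  refine ae_eq_zero_of_forall_setIntegral_isClosed_eq_zero hf fun s hs => ?_
  have hδ : ∀ n : ℕ, (0 : ℝ) < 1 / ((n : ℝ) + 1) := fun n => Nat.one_div_pos_of_nat
  have hlim := thickenedIndicator_tendsto_indicator_closure hδ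
    tendsto_one_div_add_atTop_nhds_zero_nat s
  rw [hs.closure_eq, tendsto_pi_nhds] at hlim
  have key : Tendsto (fun n : ℕ => ∫ t, ((thickenedIndicator (hδ n) s t : ℝ) : ℂ) * f t
      ∂haarAddCircle) atTop (𝓝 (∫ t, s.indicator f t ∂haarAddCircle)) := by
    refine tendsto_integral_of_dominated_convergence (fun t => ‖f t‖) (fun n => ?_) hf.norm
      (fun n => .of_forall fun t => ?_) (.of_forall fun t => ?_)
    · exact (Continuous.aestronglyMeasurable (by fun_prop)).mul hf.aestronglyMeasurable
    · rw [norm_mul]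
      refine mul_le_of_le_one_left (norm_nonneg _) ?_
      simpa using thickenedIndicator_le_one (hδ n) s t
    · have h2 : Tendsto (fun n : ℕ => ((thickenedIndicator (hδ n) s t : ℝ) : ℂ)) atTop
          (𝓝 (((s.indicator (fun _ => (1 : NNReal)) t : NNReal) : ℝ) : ℂ)) :=
        ((Complex.continuous_ofReal.comp NNReal.continuous_coe).tendsto _).comp (hlim t)
      have h3 := h2.mul_const (f t)
      by_cases hts : t ∈ s <;> simpa [hts] using h3
  rw [← integral_indicator hs.measurableSet]
  refine tendsto_nhds_unique key ?_
  have : ∀ n : ℕ, ∫ t, ((thickenedIndicator (hδ n) s t : ℝ) : ℂ) * f t ∂haarAddCircle = 0 :=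
    fun n => hcont ⟨fun t => ((thickenedIndicator (hδ n) s t : ℝ) : ℂ), by fun_prop⟩
  simp only [this]
  exact tendsto_const_nhds

variable {p : ℝ≥0∞} [Fact (1 ≤ p)]

theorem LpT_ext {f g : LpT p} (h : ∀ n, fourierCoeff (f : 𝕋 → ℂ) n = fourierCoeff (g : 𝕋 → ℂ) n) :
    f = g := by
  rw [← sub_eq_zero, Lp.eq_zero_iff_ae_eq_zero]
  refine ae_eq_zero_of_fourierCoeff_eq_zero (integrable_LpT _) fun n => ?_
  have h1 : ((f - g : LpT p) : 𝕋 → ℂ) =ᵐ[haarAddCircle]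
      ((f : 𝕋 → ℂ) + ((-1 : ℂ) • (g : 𝕋 → ℂ) : 𝕋 → ℂ) : 𝕋 → ℂ) := by
    filter_upwards [Lp.coeFn_sub f g] with t ht
    rw [ht]
    simp [sub_eq_add_neg]
  rw [fourierCoeff_congr_ae h1, fourierCoeff.add (integrable_LpT f) ((integrable_LpT g).smul _),
    Pi.add_apply, fourierCoeff.const_smul, h n]
  simp

theorem fourierCoeff_fourierLp (n k : ℤ) :
    fourierCoeff (fourierLp p n : 𝕋 → ℂ) k = if k = n then 1 else 0 := by
  rw [fourierCoeff_congr_ae (coeFn_fourierLp p n), fourierCoeff_fourier, Pi.single_apply]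

theorem IsRieszProjection.apply_fourierLp {P : LpT p →L[ℂ] LpT p} (hP : IsRieszProjection P)
    (n : ℤ) : P (fourierLp p n) = if 0 ≤ n then fourierLp p n else 0 := by
  refine LpT_ext fun k => ?_
  rw [hP]
  split_ifs with h1 h2 h2
  · rfl
  · rw [fourierCoeff_fourierLp, if_neg (by lia)]
    rw [fourierCoeff_congr_ae (Lp.coeFn_zero ℂ p haarAddCircle)]
    simp [fourierCoeff]
  · rw [fourierCoeff_fourierLp, if_neg (by lia)]
  · rw [fourierCoeff_congr_ae (Lp.coeFn_zero ℂ p haarAddCircle)]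
    simp [fourierCoeff]

/-! ### Multiplication, shifts and the flip -/

theorem coeFn_mulOp (a : LpT ∞) (f : LpT p) :
    mulOp p a f =ᵐ[haarAddCircle] fun t => a t * f t :=
  (ContinuousLinearMap.mul ℂ ℂ).coeFn_holder a f

theorem norm_mulOp_le (a : LpT ∞) : ‖mulOp p a‖ ≤ ‖a‖ := by
  refine ContinuousLinearMap.opNorm_le_bound _ (norm_nonneg _) fun f => ?_
  refine ((ContinuousLinearMap.mul ℂ ℂ).norm_holder_apply_apply_le a f).trans ?_
  simp

theorem mulOp_comm (a b : LpT ∞) (f : LpT p) :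
    mulOp p a (mulOp p b f) = mulOp p b (mulOp p a f) := by
  refine Lp.ext ?_
  filter_upwards [coeFn_mulOp a (mulOp p b f), coeFn_mulOp b (mulOp p a f), coeFn_mulOp a f,
    coeFn_mulOp b f] with t h1 h2 h3 h4
  rw [h1, h2, h3, h4]
  ring

/-- Multiplication by the character `χ_n` on `L^p`. -/
def shift (p : ℝ≥0∞) [Fact (1 ≤ p)] (n : ℤ) : LpT p →L[ℂ] LpT p :=
  mulOp p (fourierLp ∞ n)

theorem coeFn_shift (n : ℤ) (f : LpT p) :
    shift p n f =ᵐ[haarAddCircle] fun t => fourier n t * f t := by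
  filter_upwards [coeFn_mulOp (fourierLp ∞ n) f, coeFn_fourierLp ∞ n] with t h1 h2
  rw [shift, h1, h2]

theorem shift_shift (m n : ℤ) (f : LpT p) : shift p m (shift p n f) = shift p (m + n) f := by
  refine Lp.ext ?_
  filter_upwards [coeFn_shift m (shift p n f), coeFn_shift n f, coeFn_shift (m + n) f]
    with t h1 h2 h3
  rw [h1, h2, h3, fourier_add, mul_assoc]

theorem shift_zero (f : LpT p) : shift p 0 f = f := by
  refine Lp.ext ?_
  filter_upwards [coeFn_shift 0 f] with t h1
  rw [h1, fourier_zero, one_mul]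

theorem norm_shift (n : ℤ) (f : LpT p) : ‖shift p n f‖ = ‖f‖ := by
  have h : ∀ᵐ t ∂(haarAddCircle : Measure 𝕋), ‖shift p n f t‖ = ‖f t‖ := by
    filter_upwards [coeFn_shift n f] with t h1
    rw [h1, norm_mul, fourier_apply, Circle.norm_coe, one_mul]
  exact le_antisymm (Lp.norm_le_norm_of_ae_le (h.mono fun t ht => ht.le))
    (Lp.norm_le_norm_of_ae_le (h.mono fun t ht => ht.ge))

theorem shift_fourierLp (n k : ℤ) : shift p n (fourierLp p k) = fourierLp p (n + k) := by
  refine Lp.ext ?_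
  filter_upwards [coeFn_shift n (fourierLp p k), coeFn_fourierLp p k, coeFn_fourierLp p (n + k)]
    with t h1 h2 h3
  rw [h1, h2, h3, fourier_add]

theorem coeFn_reflOp (f : LpT p) : reflOp p f =ᵐ[haarAddCircle] fun t => f (-t) :=
  Lp.coeFn_compMeasurePreserving f (Measure.measurePreserving_neg haarAddCircle)

theorem reflOp_shift (n : ℤ) (f : LpT p) : reflOp p (shift p n f) = shift p (-n) (reflOp p f) := by
  refine Lp.ext ?_
  have h0 := (Measure.measurePreserving_neg (haarAddCircle : Measure 𝕋)).quasiMeasurePreserving.ae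
    (coeFn_shift n f)
  filter_upwards [coeFn_reflOp (shift p n f), coeFn_shift (-n) (reflOp p f), coeFn_reflOp f, h0]
    with t h1 h2 h3 h4
  rw [h1, h2, h3, h4]
  congr 1
  simp [fourier_apply]

/-- This reversal of frequencies is why Hankel operators vanish asymptotically along shifted
functions while Toeplitz operators do not. -/
theorem flipOp_shift (n : ℤ) (f : LpT p) : flipOp p (shift p n f) = shift p (-n) (flipOp p f) := by
  rw [flipOp, ContinuousLinearMap.comp_apply, ContinuousLinearMap.comp_apply, reflOp_shift]
  exact mulOp_comm _ _ _

/-! ### Strong limits of shifted projections -/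

/-- A uniformly bounded sequence of operators on `L^p` that tends to zero on the characters tends
to zero strongly. -/
theorem tendsto_zero_of_forall_fourierLp {F : Type*} [NormedAddCommGroup F] [NormedSpace ℂ F]
    (hp : p ≠ ∞) {T : ℕ → LpT p →L[ℂ] F} {C : ℝ} (hT : ∀ n, ‖T n‖ ≤ C)
    (h : ∀ k, Tendsto (fun n => T n (fourierLp p k)) atTop (𝓝 0)) (f : LpT p) :
    Tendsto (fun n => T n f) atTop (𝓝 0) := by
  let S : Submodule ℂ (LpT p) :=
    { carrier := {f | Tendsto (fun n => T n f) atTop (𝓝 0)}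
      add_mem' := fun {f g} hf hg => by simpa using Tendsto.add hf hg
      zero_mem' := by simp
      smul_mem' := fun c f hf => by simpa using Tendsto.const_smul hf c }
  have hS : IsClosed (S : Set (LpT p)) := by
    refine isClosed_of_closure_subset fun f hf => ?_
    change Tendsto (fun n => T n f) atTop (𝓝 0)
    have hC : 0 ≤ C := (norm_nonneg _).trans (hT 0)
    rw [Metric.tendsto_atTop]
    intro ε hε
    obtain ⟨g, hg, hfg⟩ := Metric.mem_closure_iff.1 hf (ε / (2 * (C + 1))) (by positivity)
    obtain ⟨N, hN⟩ := Metric.tendsto_atTop.1 (show Tendsto (fun n => T n g) atTop (𝓝 0) from hg)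
      (ε / 2) (by positivity)
    refine ⟨N, fun n hn => ?_⟩
    have h1 := hN n hn
    rw [dist_zero_right] at h1 ⊢
    have h2 : ‖T n (f - g)‖ ≤ C * (ε / (2 * (C + 1))) := by
      refine (T n).le_of_opNorm_le_of_le (hT n) ?_
      rw [← dist_eq_norm]
      exact hfg.le
    have h3 : C * (ε / (2 * (C + 1))) ≤ ε / 2 := by
      rw [mul_div_assoc', div_le_div_iff₀ (by positivity) (by positivity)]
      nlinarith
    have h4 : T n f = T n (f - g) + T n g := by rw [← map_add, sub_add_cancel]
    rw [h4]
    exact (norm_add_le _ _).trans_lt (by linarith)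
  have hle : Submodule.span ℂ (Set.range (fourierLp (T := 2 * Real.pi) p)) ≤ S := by
    rw [Submodule.span_le]
    rintro _ ⟨k, rfl⟩
    exact h k
  have htop := Submodule.topologicalClosure_minimal _ hle hS
  rw [span_fourierLp_closure_eq_top hp, top_le_iff] at htop
  exact (htop ▸ Submodule.mem_top : f ∈ S)

/-- On a single character `χ_k` the sequence is constant once `n ≥ |k|`, since `χ_{n+k}` then lies
in `H^p`. -/
theorem IsRieszProjection.tendsto_shift_neg_apply_shift {P : LpT p →L[ℂ] LpT p}
    (hP : IsRieszProjection P) (hp : p ≠ ∞) (f : LpT p) :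
    Tendsto (fun n : ℕ => shift p (-n) (P (shift p n f))) atTop (𝓝 f) := by
  rw [← tendsto_sub_nhds_zero_iff]
  refine tendsto_zero_of_forall_fourierLp hp (C := ‖P‖ + 1)
    (T := fun n : ℕ => shift p (-n) ∘L P ∘L shift p n - ContinuousLinearMap.id ℂ _)
    (fun n => ?_) (fun k => ?_) f
  · refine ContinuousLinearMap.opNorm_le_bound _ (by positivity) fun g => ?_
    change ‖shift p (-n) (P (shift p n g)) - g‖ ≤ _
    refine (norm_sub_le _ _).trans ?_
    rw [norm_shift]
    have := P.le_opNorm (shift p n g)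
    rw [norm_shift] at this
    linarith
  · refine tendsto_const_nhds.congr' ?_
    filter_upwards [eventually_ge_atTop k.natAbs] with n hn
    simp only [sub_apply, ContinuousLinearMap.comp_apply, shift_fourierLp,
      hP.apply_fourierLp, ContinuousLinearMap.id_apply]
    rw [if_pos (by lia), shift_fourierLp, neg_add_cancel_left, sub_self]

theorem IsRieszProjection.tendsto_apply_shift_neg {P : LpT p →L[ℂ] LpT p}
    (hP : IsRieszProjection P) (hp : p ≠ ∞) (f : LpT p) :
    Tendsto (fun n : ℕ => P (shift p (-n) f)) atTop (𝓝 0) := by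
  refine tendsto_zero_of_forall_fourierLp hp (C := ‖P‖) (T := fun n : ℕ => P ∘L shift p (-n))
    (fun n => ?_) (fun k => ?_) f
  · refine ContinuousLinearMap.opNorm_le_bound _ (by positivity) fun g => ?_
    have := P.le_opNorm (shift p (-n) g)
    rwa [norm_shift] at this
  · refine tendsto_const_nhds.congr' ?_
    -- The inequality is strict because `P` keeps `χ_0`.
    filter_upwards [eventually_gt_atTop k.natAbs] with n hn
    rw [ContinuousLinearMap.comp_apply, shift_fourierLp, hP.apply_fourierLp, if_neg (by lia)]

/-! ### Compact operators along the characters -/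

theorem norm_sum_fourierLp_two_sq {m : ℕ → ℤ} (hm : Function.Injective m) (N : ℕ) :
    ‖∑ j ∈ Finset.range N, (fourierLp 2 (m j) : LpT 2)‖ ^ 2 = N := by
  have h := (orthonormal_fourier (T := 2 * Real.pi)).comp m hm
  have h2 := h.inner_sum (fun _ => (1 : ℂ)) (fun _ => (1 : ℂ)) (Finset.range N)
  simp only [one_smul, map_one, mul_one, Finset.sum_const, Finset.card_range,
    nsmul_eq_mul, Function.comp_apply] at h2
  rw [inner_self_eq_norm_sq_to_K] at h2
  exact Complex.ofReal_injective (((RCLike.ofReal_pow _ 2).trans h2).trans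
    (Complex.ofReal_natCast N).symm)

theorem norm_toLp_le_of_exponent_le {q r : ℝ≥0∞} [Fact (1 ≤ q)] [Fact (1 ≤ r)] (hqr : q ≤ r)
    (g : C(𝕋, ℂ)) :
    ‖ContinuousMap.toLp q haarAddCircle ℂ g‖ ≤ ‖ContinuousMap.toLp r haarAddCircle ℂ g‖ := by
  rw [Lp.norm_def, Lp.norm_def]
  refine ENNReal.toReal_mono (Lp.eLpNorm_ne_top _) ?_
  rw [eLpNorm_congr_ae (ContinuousMap.coeFn_toLp haarAddCircle g),
    eLpNorm_congr_ae (ContinuousMap.coeFn_toLp haarAddCircle g)]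
  exact eLpNorm_le_eLpNorm_of_exponent_le hqr g.continuous.aestronglyMeasurable

/-- Interpolation between `L^2` and `L^∞`: a continuous function bounded by `1` that is small in
`L^2` is small in `L^p`. -/
theorem norm_toLp_le_of_norm_le_one (hp : p ≠ ∞) :
    ∃ s : ℝ, 0 < s ∧ ∀ g : C(𝕋, ℂ), ‖g‖ ≤ 1 →
      ‖ContinuousMap.toLp p haarAddCircle ℂ g‖ ≤
        ‖ContinuousMap.toLp 2 haarAddCircle ℂ g‖ ^ s := by
  rcases le_total p 2 with h2 | h2
  · exact ⟨1, one_pos, fun g _ => by rw [Real.rpow_one]; exact norm_toLp_le_of_exponent_le h2 g⟩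
  · have hp0 : p ≠ 0 := (zero_lt_two.trans_le h2).ne'
    have hpr : 2 ≤ p.toReal := by
      simpa using ENNReal.toReal_mono hp h2
    -- Since `|g| ≤ 1` and `p ≥ 2`, `|g|^p ≤ |g|^2`; taking `p`-th roots of the integrals gives the
    -- exponent `2 / p`.
    refine ⟨2 / p.toReal, by positivity, fun g hg => ?_⟩
    rw [Lp.norm_def, Lp.norm_def, ENNReal.toReal_rpow]
    refine ENNReal.toReal_mono
      (ENNReal.rpow_ne_top_of_nonneg (by positivity) (Lp.eLpNorm_ne_top _)) ?_
    rw [eLpNorm_congr_ae (ContinuousMap.coeFn_toLp haarAddCircle g),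
      eLpNorm_congr_ae (ContinuousMap.coeFn_toLp haarAddCircle g),
      eLpNorm_eq_lintegral_rpow_enorm_toReal hp0 hp,
      eLpNorm_eq_lintegral_rpow_enorm_toReal (by norm_num) (by norm_num), ← ENNReal.rpow_mul]
    have : 1 / (2 : ℝ≥0∞).toReal * (2 / p.toReal) = 1 / p.toReal := by
      rw [ENNReal.toReal_ofNat]; ring
    rw [this]
    refine ENNReal.rpow_le_rpow (lintegral_mono fun t => ?_) (by positivity)
    refine ENNReal.rpow_le_rpow_of_exponent_ge ?_ (by simpa using hpr)
    rw [← ofReal_norm]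
    exact ENNReal.ofReal_le_one.2 ((g.norm_coe_le_norm t).trans hg)

/-- Averages of distinct characters tend to zero in `L^p`. -/
theorem tendsto_average_fourierLp (hp : p ≠ ∞) {m : ℕ → ℤ} (hm : Function.Injective m) :
    Tendsto (fun N : ℕ => (N : ℝ)⁻¹ • ∑ j ∈ Finset.range N, (fourierLp p (m j) : LpT p)) atTop
      (𝓝 0) := by
  obtain ⟨s, hs, h⟩ := norm_toLp_le_of_norm_le_one hp
  let g : ℕ → C(𝕋, ℂ) := fun N => ((N : ℝ)⁻¹ : ℂ) • ∑ j ∈ Finset.range N, fourier (m j)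
  have hg : ∀ N, ‖g N‖ ≤ 1 := fun N => by
    have h1 : ‖∑ j ∈ Finset.range N, (fourier (m j) : C(𝕋, ℂ))‖ ≤ N := by
      refine (norm_sum_le _ _).trans ?_
      simp only [fourier_norm]
      simp
    rw [norm_smul]
    rcases Nat.eq_zero_or_pos N with rfl | hN
    · simp
    · rw [norm_inv, Complex.norm_real, Real.norm_natCast, inv_mul_le_iff₀ (by positivity), mul_one]
      exact h1
  have hgL : ∀ (q : ℝ≥0∞) [Fact (1 ≤ q)] (N : ℕ), ContinuousMap.toLp q haarAddCircle ℂ (g N) =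
      (N : ℝ)⁻¹ • ∑ j ∈ Finset.range N, (fourierLp q (m j) : LpT q) := by
    intro q _ N
    rw [map_smul, map_sum]
    norm_cast
  have h2 : ∀ N : ℕ, ‖ContinuousMap.toLp 2 haarAddCircle ℂ (g N)‖ = (N : ℝ) ^ (-(1 / 2) : ℝ) := by
    intro N
    have := norm_sum_fourierLp_two_sq hm N
    rw [hgL, norm_smul, norm_inv, Real.norm_natCast,
      ← Real.sqrt_sq (norm_nonneg (∑ j ∈ Finset.range N, (fourierLp 2 (m j) : LpT 2))), this,
      Real.sqrt_eq_rpow]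
    rcases Nat.eq_zero_or_pos N with rfl | hN
    · norm_num
    · rw [← Real.rpow_neg_one, ← Real.rpow_add (by positivity)]
      norm_num
  rw [tendsto_zero_iff_norm_tendsto_zero]
  refine squeeze_zero (fun N => norm_nonneg _) (fun N => (hgL p N ▸ h (g N) (hg N))) ?_
  simp only [h2]
  have h3 : Tendsto (fun N : ℕ => (N : ℝ) ^ (-(1 / 2 * s))) atTop (𝓝 0) :=
    (tendsto_rpow_neg_atTop (by positivity)).comp tendsto_natCast_atTop_atTop
  refine h3.congr fun N => ?_
  rw [← Real.rpow_mul (Nat.cast_nonneg N), neg_mul]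

/-- The characters form a sequence that every compact operator maps to a null sequence. -/
theorem tendsto_compact_fourierLp {F : Type*} [NormedAddCommGroup F] [NormedSpace ℂ F]
    (hp : p ≠ ∞) {K : LpT p →L[ℂ] F} (hK : IsCompactOperator K) (k : ℤ) :
    Tendsto (fun n : ℕ => K (fourierLp p (n + k))) atTop (𝓝 0) := by
  refine tendsto_of_subseq_tendsto fun ns hns => ?_
  -- Strict monotonicity keeps the characters distinct, as the averaging argument needs.
  obtain ⟨φ, hφ, hφ'⟩ := strictMono_subseq_of_tendsto_atTop hns
  obtain ⟨S, hS, hKS⟩ := hK.image_closedBall_subset_compact (f := K.toLinearMap) 1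
  have hmem : ∀ n : ℕ, K (fourierLp p ((ns (φ n) : ℤ) + k)) ∈ S := fun n => by
    refine hKS ⟨_, ?_, rfl⟩
    rw [mem_closedBall_zero_iff]
    refine (Lp.norm_le_of_ae_bound zero_le_one ?_).trans ?_
    · filter_upwards [coeFn_fourierLp p ((ns (φ n) : ℤ) + k)] with t ht
      rw [ht, fourier_apply, Circle.norm_coe]
    · simp [measureUnivNNReal]
  obtain ⟨g, -, ψ, hψ, hg⟩ := hS.tendsto_subseq hmem
  refine ⟨φ ∘ ψ, ?_⟩
  have hinj : Function.Injective fun j => ((ns (φ (ψ j)) : ℤ) + k) := fun i j hij => by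
    have : ns (φ (ψ i)) = ns (φ (ψ j)) := by simpa using hij
    exact hψ.injective (hφ'.injective this)
  have h1 := (K.continuous.tendsto _).comp (tendsto_average_fourierLp hp hinj)
  rw [map_zero] at h1
  -- The limit `g` is also the Cesàro limit, which is the limit of `K` on averages of distinct
  -- characters, hence zero. No description of the dual of `L^p` is needed.
  have h2 := hg.cesaro_smul
  have : g = 0 := by
    refine tendsto_nhds_unique h2 (h1.congr fun N => ?_)
    rw [Function.comp_apply, ContinuousLinearMap.map_smul_of_tower, map_sum]
    rfl
  rw [this] at hg
  exact hg

theorem tendsto_compact_shift {F : Type*} [NormedAddCommGroup F] [NormedSpace ℂ F]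
    (hp : p ≠ ∞) {K : LpT p →L[ℂ] F} (hK : IsCompactOperator K) (f : LpT p) :
    Tendsto (fun n : ℕ => K (shift p n f)) atTop (𝓝 0) := by
  refine tendsto_zero_of_forall_fourierLp hp (C := ‖K‖) (T := fun n : ℕ => K ∘L shift p n)
    (fun n => ?_) (fun k => ?_) f
  · refine ContinuousLinearMap.opNorm_le_bound _ (by positivity) fun g => ?_
    have := K.le_opNorm (shift p n g)
    rwa [norm_shift] at this
  · simp only [ContinuousLinearMap.comp_apply, shift_fourierLp]
    exact tendsto_compact_fourierLp hp hK k

/-! ### The bounds for the symbol and for Toeplitz operators -/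

/-- The norm of `a` in `L^∞` is bounded by the norm of the multiplication operator. -/
theorem norm_le_of_norm_mulOp_le {a : LpT ∞} {M : ℝ} (hM : 0 ≤ M)
    (h : ∀ f : LpT p, ‖mulOp p a f‖ ≤ M * ‖f‖) : ‖a‖ ≤ M := by
  refine le_of_forall_pos_le_add fun ε hε => ?_
  have hp0 : p ≠ 0 := (zero_lt_one.trans_le Fact.out).ne'
  have hmeas : MeasurableSet {t | M + ε ≤ ‖a t‖} :=
    measurableSet_le measurable_const (Lp.stronglyMeasurable a).norm.measurable
  -- On this set `|a| ≥ M + ε`, so `(M + ε) ‖f‖ ≤ ‖a f‖ ≤ M ‖f‖`, which forces the set to be null.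
  let f : LpT p := indicatorConstLp p hmeas (measure_ne_top haarAddCircle _) 1
  have hf : f =ᵐ[haarAddCircle] Set.indicator {t | M + ε ≤ ‖a t‖} fun _ => (1 : ℂ) :=
    indicatorConstLp_coeFn
  have h1 : ‖((M + ε : ℝ) : ℂ) • f‖ ≤ ‖mulOp p a f‖ := by
    refine Lp.norm_le_norm_of_ae_le ?_
    filter_upwards [Lp.coeFn_smul ((M + ε : ℝ) : ℂ) f, coeFn_mulOp a f, hf] with t h1 h2 h3
    rw [h1, h2, Pi.smul_apply, h3]
    by_cases ht : t ∈ {t | M + ε ≤ ‖a t‖}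
    · simp only [Set.indicator_of_mem ht, smul_eq_mul, mul_one, Complex.norm_real]
      rw [Real.norm_of_nonneg (by positivity)]
      exact ht
    · simp [Set.indicator_of_notMem ht]
  rw [norm_smul, Complex.norm_real, Real.norm_of_nonneg (by positivity)] at h1
  have h2 : ‖f‖ = 0 := by
    have := h f
    nlinarith [norm_nonneg f]
  have h3 : (haarAddCircle : Measure 𝕋) {t | M + ε ≤ ‖a t‖} = 0 := by
    rw [norm_eq_zero, Lp.eq_zero_iff_ae_eq_zero] at h2
    rw [← compl_compl {t | M + ε ≤ ‖a t‖}, ← mem_ae_iff]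
    filter_upwards [h2, hf] with t h4 h5 ht
    rw [h5, Set.indicator_of_mem ht] at h4
    exact one_ne_zero h4
  have h4 : ∀ᵐ t ∂(haarAddCircle : Measure 𝕋), ‖a t‖ ≤ M + ε := by
    rw [← compl_compl {t | M + ε ≤ ‖a t‖}, ← mem_ae_iff] at h3
    filter_upwards [h3] with t ht
    exact (lt_of_not_ge (Set.mem_compl_iff _ _ |>.1 ht)).le
  simpa using Lp.norm_le_of_ae_bound (by positivity) h4

theorem norm_mulOp_apply_le_of_isCompactOperator (hR : IsRieszProjection (rieszProjection p))
    (hp : p ≠ ∞) (a b : LpT ∞) {K : Hp p →L[ℂ] Hp p} (hK : IsCompactOperator K) (f : LpT p) :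
    ‖mulOp p a f‖ ≤ ‖toeplitz p a + hankel p b + K‖ * ‖f‖ := by
  let x : ℕ → Hp p := fun n => rieszToHp p (shift p n f)
  have hx : Tendsto (fun n : ℕ => shift p (-n) (x n : LpT p)) atTop (𝓝 f) :=
    hR.tendsto_shift_neg_apply_shift hp f
  have hx0 : Tendsto (fun n : ℕ => shift p (-n) (x n : LpT p) - f) atTop (𝓝 0) :=
    tendsto_sub_nhds_zero_iff.2 hx
  have hshift : ∀ (n : ℤ) (g : LpT p), shift p n (shift p (-n) g) = g := fun n g => by
    rw [shift_shift, add_neg_cancel, shift_zero]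
  have hnx : Tendsto (fun n => ‖x n‖) atTop (𝓝 ‖f‖) := by
    refine hx.norm.congr fun n => ?_
    rw [norm_shift, Submodule.coe_norm]
  have hT : Tendsto (fun n => ‖toeplitz p a (x n)‖) atTop (𝓝 ‖mulOp p a f‖) := by
    have h1 := hR.tendsto_shift_neg_apply_shift hp (mulOp p a f)
    -- Write `a x_n = χ_n a (χ_{-n} x_n)` and split `χ_{-n} x_n` into `f` and an error; this is the
    -- contribution of the error.
    have h2 : Tendsto (fun n : ℕ => shift p (-n) (rieszProjection p (shift p n
        (mulOp p a (shift p (-n) (x n : LpT p) - f))))) atTop (𝓝 0) := by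
      refine squeeze_zero_norm (a := fun n : ℕ => ‖rieszProjection p‖ * (‖mulOp p a‖ *
        ‖shift p (-n) (x n : LpT p) - f‖)) (fun n => ?_) ?_
      · rw [norm_shift]
        refine (rieszProjection p).le_opNorm_of_le ?_
        rw [norm_shift]
        exact (mulOp p a).le_opNorm _
      · simpa using (hx0.norm.const_mul ‖mulOp p a‖).const_mul ‖rieszProjection p‖
    have h3 := h1.add h2
    rw [add_zero] at h3
    refine h3.norm.congr fun n => ?_
    rw [← map_add, ← map_add, ← map_add, ← map_add, add_sub_cancel, norm_shift]
    change _ = ‖rieszProjection p (mulOp p a (x n : LpT p))‖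
    rw [shift, ← mulOp_comm]
    change ‖rieszProjection p (mulOp p a (shift p n (shift p (-n) (x n : LpT p))))‖ = _
    rw [hshift]
  have hH : Tendsto (fun n => ‖hankel p b (x n)‖) atTop (𝓝 0) := by
    -- The same splitting, now for `H(b) x_n = P χ_{-n} b J(χ_{-n} x_n)`.
    have h1 := hR.tendsto_apply_shift_neg hp (mulOp p b (flipOp p f))
    have h2 : Tendsto (fun n : ℕ => rieszProjection p (shift p (-n)
        (mulOp p b (flipOp p (shift p (-n) (x n : LpT p) - f))))) atTop (𝓝 0) := by
      refine squeeze_zero_norm (a := fun n : ℕ => ‖rieszProjection p‖ * (‖mulOp p b‖ *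
        (‖flipOp p‖ * ‖shift p (-n) (x n : LpT p) - f‖))) (fun n => ?_) ?_
      · refine (rieszProjection p).le_opNorm_of_le ?_
        rw [norm_shift]
        exact (mulOp p b).le_opNorm_of_le ((flipOp p).le_opNorm _)
      · simpa using ((hx0.norm.const_mul ‖flipOp p‖).const_mul ‖mulOp p b‖).const_mul
          ‖rieszProjection p‖
    have h3 := (h1.add h2).norm
    rw [add_zero, norm_zero] at h3
    refine h3.congr fun n => ?_
    rw [← map_add, ← map_add, ← map_add, ← map_add, add_sub_cancel]
    change _ = ‖rieszProjection p (mulOp p b (flipOp p (x n : LpT p)))‖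
    rw [shift, mulOp_comm]
    change ‖rieszProjection p (mulOp p b (shift p (-n) (flipOp p (shift p (-n) (x n : LpT p)))))‖
      = _
    rw [← flipOp_shift, hshift]
  have hKx : Tendsto (fun n => ‖K (x n)‖) atTop (𝓝 0) := by
    have := tendsto_compact_shift hp (K := K ∘L rieszToHp p) (hK.comp_clm _) f
    simpa using this.norm
  have hR1 : Tendsto (fun n => ‖toeplitz p a + hankel p b + K‖ * ‖x n‖ + ‖hankel p b (x n)‖
      + ‖K (x n)‖) atTop (𝓝 (‖toeplitz p a + hankel p b + K‖ * ‖f‖ + 0 + 0)) :=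
    ((hnx.const_mul _).add hH).add hKx
  rw [add_zero, add_zero] at hR1
  refine le_of_tendsto_of_tendsto' hT hR1 fun n => ?_
  have h1 := (toeplitz p a + hankel p b + K).le_opNorm (x n)
  have h2 : toeplitz p a (x n) =
      (toeplitz p a + hankel p b + K) (x n) - hankel p b (x n) - K (x n) := by
    simp only [add_apply]
    abel
  rw [h2]
  refine (norm_sub_le _ _).trans (add_le_add_left ((norm_sub_le _ _).trans ?_) _)
  exact add_le_add_left h1 _

theorem norm_toeplitz_le (a : LpT ∞) : ‖toeplitz p a‖ ≤ ‖rieszProjection p‖ * ‖a‖ := by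
  refine ContinuousLinearMap.opNorm_le_bound _ (by positivity) fun f => ?_
  change ‖rieszProjection p (mulOp p a (f : LpT p))‖ ≤ _
  rw [mul_assoc]
  exact (rieszProjection p).le_opNorm_of_le
    ((mulOp p a).le_of_opNorm_le (norm_mulOp_le a) _)

/-! ### The M. Riesz inequality for `1 < p ≤ 2` -/

/-- With `θ = arg w`, homogeneity reduces this to `1 ≤ A cos^r θ - B cos (rθ)` for `|θ| < π/2`. Away
from `±π/2` the first term is bounded below; near `±π/2`, `cos (rθ)` is negative because `1 < r ≤
2`. -/
theorem exists_norm_rpow_le_re {r : ℝ} (hr1 : 1 < r) (hr2 : r ≤ 2) :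
    ∃ A B : ℝ, 0 ≤ A ∧ 0 ≤ B ∧ ∀ w : ℂ, 0 < w.re →
      ‖w‖ ^ r ≤ A * w.re ^ r - B * (w ^ (r : ℂ)).re := by
  have hπ := Real.pi_pos
  obtain ⟨x, hx1, hx2⟩ : ∃ x, Real.pi / (2 * r) < x ∧ x < Real.pi / 2 :=
    exists_between (div_lt_div_of_pos_left hπ (by positivity) (by linarith))
  have hx0 : 0 < x := lt_trans (by positivity) hx1
  rw [div_lt_iff₀ (by positivity)] at hx1
  have hcx : 0 < Real.cos x := Real.cos_pos_of_mem_Ioo ⟨by linarith, hx2⟩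
  have hcr : Real.cos (x * r) < 0 :=
    Real.cos_neg_of_pi_div_two_lt_of_lt (by linarith) (by nlinarith)
  -- `B` makes `-B cos (rθ) ≥ 1` for `|θ| ≥ x`. The factor `1 + B` in `A` absorbs the worst case
  -- `cos (rθ) = 1` for `|θ| ≤ x`.
  set B : ℝ := (-Real.cos (x * r))⁻¹ with hB
  have hB0 : 0 < B := inv_pos.2 (by linarith)
  have hcxr : 0 < Real.cos x ^ r := Real.rpow_pos_of_pos hcx r
  refine ⟨(1 + B) / Real.cos x ^ r, B, by positivity, hB0.le, fun w hw => ?_⟩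
  have hw0 : w ≠ 0 := fun h => by simp [h] at hw
  have hn : 0 < ‖w‖ := norm_pos_iff.2 hw0
  have harg : |w.arg| < Real.pi / 2 := Complex.abs_arg_lt_pi_div_two_iff.2 (Or.inl hw)
  have hre : w.re = ‖w‖ * Real.cos |w.arg| := by rw [Real.cos_abs, Complex.norm_mul_cos_arg]
  have hcos : 0 < Real.cos |w.arg| := by
    by_contra! h
    nlinarith
  have hcr' : Real.cos (w.arg * r) = Real.cos (|w.arg| * r) := by
    rw [← Real.cos_abs (w.arg * r), abs_mul, abs_of_pos (by linarith : 0 < r)]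
  rw [Complex.cpow_ofReal_re, hcr', hre, Real.mul_rpow hn.le hcos.le]
  have key : 1 ≤ (1 + B) / Real.cos x ^ r * Real.cos |w.arg| ^ r
      - B * Real.cos (|w.arg| * r) := by
    rcases le_total |w.arg| x with h | h
    · have h1 : Real.cos x ≤ Real.cos |w.arg| :=
        Real.cos_le_cos_of_nonneg_of_le_pi (abs_nonneg _) (by linarith) h
      have h2 : Real.cos x ^ r ≤ Real.cos |w.arg| ^ r :=
        Real.rpow_le_rpow hcx.le h1 (by linarith)
      have h3 : 1 + B ≤ (1 + B) / Real.cos x ^ r * Real.cos |w.arg| ^ r := by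
        rw [div_mul_eq_mul_div, le_div_iff₀ hcxr]
        gcongr
      nlinarith [Real.cos_le_one (|w.arg| * r)]
    · have h1 : Real.cos (|w.arg| * r) ≤ Real.cos (x * r) :=
        Real.cos_le_cos_of_nonneg_of_le_pi (by positivity) (by nlinarith) (by gcongr)
      have h2 : B * -Real.cos (x * r) = 1 := inv_mul_cancel₀ (by linarith)
      have h3 : 0 ≤ (1 + B) / Real.cos x ^ r * Real.cos |w.arg| ^ r := by positivity
      nlinarith
  have := mul_le_mul_of_nonneg_left key (Real.rpow_pos_of_pos hn r).le
  linarith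

theorem toAddCircle_coe (Q : Polynomial ℂ) (θ : ℝ) :
    Q.toAddCircle (θ : 𝕋) = Q.eval (circleMap 0 1 θ) := by
  have : (toCircle (θ : 𝕋) : ℂ) = circleMap 0 1 θ := by
    rw [toCircle_apply_mk]
    simp [circleMap, mul_comm]
  rw [← this]
  simp [Polynomial.toAddCircle, Polynomial.aeval_def, Polynomial.eval₂_eq_sum_range,
    Polynomial.eval_eq_sum_range]

theorem integral_toAddCircle (Q : Polynomial ℂ) (φ : ℂ → ℂ) :
    ∫ t, φ (Q.toAddCircle t) ∂haarAddCircle =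
      Real.circleAverage (fun z => φ (Q.eval z)) 0 1 := by
  rw [integral_haarAddCircle, Real.circleAverage_def,
    ← AddCircle.intervalIntegral_preimage (2 * Real.pi) 0, zero_add]
  simp only [toAddCircle_coe]

/-- The maximum principle for `exp (-Q)`, whose modulus is `exp (-Re Q)`. -/
theorem re_eval_pos {Q : Polynomial ℂ} (hQ : ∀ t : 𝕋, 0 < (Q.toAddCircle t).re) {z : ℂ}
    (hz : z ∈ Metric.closedBall (0 : ℂ) 1) : 0 < (Q.eval z).re := by
  obtain ⟨t₀, -, ht₀⟩ := (isCompact_univ (X := 𝕋)).exists_isMinOn Set.univ_nonempty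
    (f := fun t => (Q.toAddCircle t).re)
    (Complex.continuous_re.comp Q.toAddCircle.continuous).continuousOn
  have hd : Differentiable ℂ fun z => Complex.exp (-Q.eval z) :=
    (Polynomial.differentiable Q).neg.cexp
  have h := Complex.norm_le_of_forall_mem_frontier_norm_le (U := Metric.ball (0 : ℂ) 1)
    (f := fun z => Complex.exp (-Q.eval z)) (C := Real.exp (-(Q.toAddCircle t₀).re))
    Metric.isBounded_ball hd.diffContOnCl (fun w hw => ?_)
    (z := z) (by rwa [closure_ball _ one_ne_zero])
  · rw [Complex.norm_exp, Real.exp_le_exp, Complex.neg_re, neg_le_neg_iff] at h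
    exact (hQ t₀).trans_le h
  · rw [frontier_ball _ one_ne_zero] at hw
    have : w ∈ Set.range (circleMap 0 1) := by rw [range_circleMap]; simpa using hw
    obtain ⟨θ, rfl⟩ := this
    rw [Complex.norm_exp, Real.exp_le_exp, Complex.neg_re, neg_le_neg_iff, ← toAddCircle_coe]
    exact ht₀ (Set.mem_univ (θ : 𝕋))

/-- Mean value property of `Q ^ r` for a polynomial `Q` with positive real part on the circle. -/
theorem integral_toAddCircle_cpow {Q : Polynomial ℂ} (hQ : ∀ t : 𝕋, 0 < (Q.toAddCircle t).re)
    (r : ℂ) : ∫ t, Q.toAddCircle t ^ r ∂haarAddCircle = Q.eval 0 ^ r := by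
  rw [integral_toAddCircle Q (fun w => w ^ r)]
  refine DiffContOnCl.circleAverage (f := fun z => Q.eval z ^ r) (DifferentiableOn.diffContOnCl ?_)
  rw [abs_one, closure_ball _ one_ne_zero]
  exact (Polynomial.differentiable Q).differentiableOn.cpow (differentiableOn_const _)
    fun z hz => Or.inl (re_eval_pos hQ hz)

/-- Integrating the pointwise inequality, the mean of `Re (Q^r)` is `Q(0)^r`, which is positive
because `Q(0)` is real and positive; that term can be dropped. -/
theorem integral_norm_toAddCircle_rpow_le {r : ℝ} (hr1 : 1 < r) (hr2 : r ≤ 2) :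
    ∃ A : ℝ, 0 ≤ A ∧ ∀ Q : Polynomial ℂ, (∀ t : 𝕋, 0 < (Q.toAddCircle t).re) →
      (Q.eval 0).im = 0 →
      ∫ t, ‖Q.toAddCircle t‖ ^ r ∂haarAddCircle ≤
        A * ∫ t, (Q.toAddCircle t).re ^ r ∂haarAddCircle := by
  obtain ⟨A, B, hA, hB, h⟩ := exists_norm_rpow_le_re hr1 hr2
  have hr0 : 0 ≤ r := by linarith
  refine ⟨A, hA, fun Q hQ h0 => ?_⟩
  have hc1 : Continuous fun t : 𝕋 => ‖Q.toAddCircle t‖ ^ r :=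
    Q.toAddCircle.continuous.norm.rpow_const fun _ => Or.inr hr0
  have hc2 : Continuous fun t : 𝕋 => (Q.toAddCircle t).re ^ r :=
    (Complex.continuous_re.comp Q.toAddCircle.continuous).rpow_const fun _ => Or.inr hr0
  have hc3 : Continuous fun t : 𝕋 => Q.toAddCircle t ^ (r : ℂ) :=
    Q.toAddCircle.continuous.cpow continuous_const
      fun t => Or.inl (hQ t)
  have hi : ∀ {E : Type} [NormedAddCommGroup E] {f : 𝕋 → E}, Continuous f →
      Integrable f haarAddCircle := fun hf => hf.integrable_of_hasCompactSupport
        (HasCompactSupport.of_compactSpace _)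
  have hre : ∫ t, (Q.toAddCircle t ^ (r : ℂ)).re ∂haarAddCircle = (Q.eval 0).re ^ r := by
    have h1 := integral_re (hi hc3)
    rw [integral_toAddCircle_cpow hQ] at h1
    refine h1.trans ?_
    have h2 : Q.eval 0 = ((Q.eval 0).re : ℂ) := Complex.ext rfl (by simpa using h0)
    rw [h2, ← Complex.ofReal_cpow (re_eval_pos hQ (by simp)).le]
    simp
  have hc3' : Continuous fun t : 𝕋 => (Q.toAddCircle t ^ (r : ℂ)).re :=
    Complex.continuous_re.comp hc3
  calc ∫ t, ‖Q.toAddCircle t‖ ^ r ∂haarAddCircle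
      ≤ ∫ t, (A * (Q.toAddCircle t).re ^ r - B * (Q.toAddCircle t ^ (r : ℂ)).re)
          ∂haarAddCircle :=
        integral_mono (hi hc1) (((hi hc2).const_mul A).sub ((hi hc3').const_mul B))
          fun t => h _ (hQ t)
    _ = A * ∫ t, (Q.toAddCircle t).re ^ r ∂haarAddCircle - B * (Q.eval 0).re ^ r := by
        rw [integral_sub ((hi hc2).const_mul A) ((hi hc3').const_mul B), integral_const_mul,
          integral_const_mul, hre]
    _ ≤ _ := by
        have := Real.rpow_nonneg (re_eval_pos hQ (z := 0) (by simp)).le r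
        have := mul_nonneg hB this
        linarith

/-- The class in `L^p` of a continuous function. -/
abbrev contToLp (p : ℝ≥0∞) [Fact (1 ≤ p)] : C(𝕋, ℂ) →L[ℂ] LpT p :=
  ContinuousMap.toLp p haarAddCircle ℂ

theorem coeFn_contToLp (p : ℝ≥0∞) [Fact (1 ≤ p)] (f : C(𝕋, ℂ)) :
    contToLp p f =ᵐ[haarAddCircle] f :=
  ContinuousMap.coeFn_toLp haarAddCircle f

theorem norm_contToLp (hp : p ≠ ∞) (f : C(𝕋, ℂ)) :
    ‖contToLp p f‖ = (∫ t, ‖f t‖ ^ p.toReal ∂haarAddCircle) ^ p.toReal⁻¹ := by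
  have hp0 : p ≠ 0 := (zero_lt_one.trans_le Fact.out).ne'
  have hf : MemLp f p (haarAddCircle : Measure 𝕋) :=
    (Lp.memLp (contToLp p f)).ae_eq (coeFn_contToLp p f)
  rw [Lp.norm_def, eLpNorm_congr_ae (coeFn_contToLp p f),
    hf.eLpNorm_eq_integral_rpow_norm hp0 hp, ENNReal.toReal_ofReal]
  exact Real.rpow_nonneg (integral_nonneg fun t => Real.rpow_nonneg (norm_nonneg _) _) _

theorem norm_contToLp_mono (p : ℝ≥0∞) [Fact (1 ≤ p)] {f g : C(𝕋, ℂ)} (h : ∀ t, ‖f t‖ ≤ ‖g t‖) :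
    ‖contToLp p f‖ ≤ ‖contToLp p g‖ := by
  refine Lp.norm_le_norm_of_ae_le ?_
  filter_upwards [coeFn_contToLp p f,
    coeFn_contToLp p g] with t h1 h2
  rw [h1, h2]
  exact h t

theorem norm_contToLp_le (p : ℝ≥0∞) [Fact (1 ≤ p)] (f : C(𝕋, ℂ)) : ‖contToLp p f‖ ≤ ‖f‖ := by
  refine (Lp.norm_le_of_ae_bound (norm_nonneg f) ?_).trans (by simp [measureUnivNNReal])
  filter_upwards [coeFn_contToLp p f] with t h1
  rw [h1]
  exact f.norm_coe_le_norm t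

/-- The real part of a continuous function, as a complex-valued function. -/
def rePart (f : C(𝕋, ℂ)) : C(𝕋, ℂ) := ⟨fun t => ((f t).re : ℂ), by fun_prop⟩

theorem rePart_add (f g : C(𝕋, ℂ)) : rePart (f + g) = rePart f + rePart g := by
  ext t
  simp [rePart]

/-- The M. Riesz inequality for polynomials with positive real part. -/
theorem norm_contToLp_toAddCircle_le (hp1 : 1 < p) (hp2 : p ≤ 2) :
    ∃ C : ℝ, 0 ≤ C ∧ ∀ Q : Polynomial ℂ, (∀ t : 𝕋, 0 < (Q.toAddCircle t).re) →
      (Q.eval 0).im = 0 →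
      ‖contToLp p Q.toAddCircle‖ ≤ C * ‖contToLp p (rePart Q.toAddCircle)‖ := by
  have hp : p ≠ ∞ := (hp2.trans_lt (by norm_num)).ne
  have hr1 : 1 < p.toReal := by simpa using (ENNReal.toReal_lt_toReal (by simp) hp).2 hp1
  have hr2 : p.toReal ≤ 2 := by simpa using ENNReal.toReal_mono (by simp) hp2
  obtain ⟨A, hA, h⟩ := integral_norm_toAddCircle_rpow_le hr1 hr2
  refine ⟨A ^ p.toReal⁻¹, by positivity, fun Q hQ h0 => ?_⟩
  rw [norm_contToLp hp, norm_contToLp hp, ← Real.mul_rpow hA]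
  · refine Real.rpow_le_rpow ?_ ((h Q hQ h0).trans_eq ?_) (by positivity)
    · exact integral_nonneg fun t => Real.rpow_nonneg (norm_nonneg _) _
    · congr 2
      ext t
      simp only [rePart, ContinuousMap.coe_mk, Complex.norm_real]
      rw [Real.norm_of_nonneg (hQ t).le]
  · exact integral_nonneg fun t => Real.rpow_nonneg (norm_nonneg _) _

/-- The inclusion `L^q ⊆ L^p` for `p ≤ q`. -/
def lpIncl {p q : ℝ≥0∞} [Fact (1 ≤ p)] [Fact (1 ≤ q)] (h : p ≤ q) : LpT q →L[ℂ] LpT p :=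
  LinearMap.mkContinuous
    { toFun := fun f => ((Lp.memLp f).mono_exponent h).toLp f
      map_add' := fun f g => by
        rw [← MemLp.toLp_add]
        exact MemLp.toLp_congr _ _ (Lp.coeFn_add f g)
      map_smul' := fun c f => by
        rw [RingHom.id_apply, ← MemLp.toLp_const_smul]
        exact MemLp.toLp_congr _ _ (Lp.coeFn_smul c f) } 1 fun f => by
    rw [one_mul, LinearMap.coe_mk, AddHom.coe_mk, Lp.norm_toLp, Lp.norm_def]
    exact ENNReal.toReal_mono (Lp.eLpNorm_ne_top _)
      (eLpNorm_le_eLpNorm_of_exponent_le h (Lp.aestronglyMeasurable f))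

theorem coeFn_lpIncl {p q : ℝ≥0∞} [Fact (1 ≤ p)] [Fact (1 ≤ q)] (h : p ≤ q) (f : LpT q) :
    lpIncl h f =ᵐ[haarAddCircle] f :=
  MemLp.coeFn_toLp ((Lp.memLp f).mono_exponent h)

theorem lpIncl_contToLp {p q : ℝ≥0∞} [Fact (1 ≤ p)] [Fact (1 ≤ q)] (h : p ≤ q) (f : C(𝕋, ℂ)) :
    lpIncl h (contToLp q f) = contToLp p f :=
  Lp.ext ((coeFn_lpIncl h _).trans ((coeFn_contToLp q f).trans (coeFn_contToLp p f).symm))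

/-- The Riesz projection on `L^2`, as an orthogonal projection. -/
def hardyProj : LpT 2 →L[ℂ] LpT 2 :=
  (Submodule.span ℂ
    (Set.range fun n : ℕ => (fourierLp 2 n : LpT 2))).topologicalClosure.starProjection

theorem hardyProj_fourierLp (n : ℤ) :
    hardyProj (fourierLp 2 n) = if 0 ≤ n then fourierLp 2 n else 0 := by
  unfold hardyProj
  split_ifs with h
  · rw [Submodule.starProjection_eq_self_iff]
    lift n to ℕ using h
    exact Submodule.le_topologicalClosure _ (Submodule.subset_span ⟨n, rfl⟩)
  · rw [Submodule.starProjection_apply_eq_zero_iff, Submodule.orthogonal_closure,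
      Submodule.mem_orthogonal]
    intro u hu
    induction hu using Submodule.span_induction with
    | mem x hx =>
      obtain ⟨k, rfl⟩ := hx
      exact orthonormal_fourier.2 (by lia)
    | zero => simp
    | add x y _ _ hx hy => rw [inner_add_left, hx, hy, add_zero]
    | smul c x _ hx => rw [inner_smul_left, hx, mul_zero]

theorem inner_hardyProj (f g : LpT 2) : inner ℂ (hardyProj f) g = inner ℂ f (hardyProj g) :=
  Submodule.inner_starProjection_left_eq_right _ f g

/-- The analytic part of a continuous function, as an element of `L^p` for `p ≤ 2`. -/
def analyticPart (hp2 : p ≤ 2) : C(𝕋, ℂ) →L[ℂ] LpT p :=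
  lpIncl hp2 ∘L hardyProj ∘L contToLp 2

theorem analyticPart_fourier (hp2 : p ≤ 2) (n : ℤ) :
    analyticPart hp2 (fourier n) = if 0 ≤ n then fourierLp p n else 0 := by
  change lpIncl hp2 (hardyProj (fourierLp 2 n)) = _
  rw [hardyProj_fourierLp]
  split_ifs
  · exact lpIncl_contToLp hp2 _
  · exact map_zero _

theorem analyticPart_toAddCircle (hp2 : p ≤ 2) (Q : Polynomial ℂ) :
    analyticPart hp2 Q.toAddCircle = contToLp p Q.toAddCircle := by
  induction Q using Polynomial.induction_on' with
  | add P Q hP hQ => rw [map_add, map_add, map_add, hP, hQ]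
  | monomial n c =>
    rw [Polynomial.toAddCircle_monomial_eq_smul_fourier, map_smul, map_smul, analyticPart_fourier,
      if_pos (by positivity)]

/-- The conjugate has only frequencies `≤ 0`, so just the constant term survives. -/
theorem analyticPart_star_toAddCircle (hp2 : p ≤ 2) (Q : Polynomial ℂ) :
    analyticPart hp2 (star Q.toAddCircle) = contToLp p (star (Q.eval 0) • fourier 0) := by
  induction Q using Polynomial.induction_on' with
  | add P Q hP hQ => rw [map_add, star_add, map_add, hP, hQ, Polynomial.eval_add, star_add,
      add_smul, map_add]
  | monomial n c =>
    have h : star (fourier (T := 2 * Real.pi) n) = fourier (-n) := by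
      ext t
      rw [fourier_neg]
      rfl
    rw [Polynomial.toAddCircle_monomial_eq_smul_fourier, star_smul, h, map_smul,
      analyticPart_fourier, Polynomial.eval_monomial]
    rcases Nat.eq_zero_or_pos n with rfl | hn
    · simp
    · rw [if_neg (by lia), zero_pow hn.ne']
      simp

theorem rePart_eq (f : C(𝕋, ℂ)) : rePart f = (1 / 2 : ℂ) • (f + star f) := by
  ext t
  simp only [rePart, ContinuousMap.coe_mk, ContinuousMap.smul_apply, ContinuousMap.add_apply,
    ContinuousMap.star_apply, smul_eq_mul]
  rw [Complex.re_eq_add_conj, starRingEnd_apply]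
  ring

theorem norm_eval_zero_le (Q : Polynomial ℂ) : ‖Q.eval 0‖ ≤ ‖contToLp p Q.toAddCircle‖ := by
  have h1 : ∫ t, Q.toAddCircle t ∂haarAddCircle = Q.eval 0 := by
    rw [integral_toAddCircle Q (fun w => w)]
    exact (Polynomial.differentiable Q).diffContOnCl.circleAverage
  have h2 := norm_contToLp (p := 1) (by simp) Q.toAddCircle
  simp only [ENNReal.toReal_one, Real.rpow_one, inv_one] at h2
  rw [← h1]
  exact (norm_integral_le_integral_norm _).trans
    (h2.symm.trans_le (norm_toLp_le_of_exponent_le Fact.out _))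

theorem norm_analyticPart_rePart_toAddCircle_le (hp1 : 1 < p) (hp2 : p ≤ 2) :
    ∃ C : ℝ, 0 ≤ C ∧ ∀ Q : Polynomial ℂ, (∀ t : 𝕋, 0 < (Q.toAddCircle t).re) →
      ‖analyticPart hp2 (rePart Q.toAddCircle)‖ ≤ C * ‖contToLp p (rePart Q.toAddCircle)‖ := by
  obtain ⟨C, hC, h⟩ := norm_contToLp_toAddCircle_le hp1 hp2
  have key : ∀ Q : Polynomial ℂ, (∀ t : 𝕋, 0 < (Q.toAddCircle t).re) → (Q.eval 0).im = 0 →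
      ‖analyticPart hp2 (rePart Q.toAddCircle)‖ ≤ C * ‖contToLp p (rePart Q.toAddCircle)‖ := by
    intro Q hQ h0
    refine le_trans ?_ (h Q hQ h0)
    rw [rePart_eq, map_smul, map_add, analyticPart_toAddCircle, analyticPart_star_toAddCircle,
      norm_smul]
    have h1 : ‖contToLp p (star (Q.eval 0) • fourier 0)‖ ≤ ‖contToLp p Q.toAddCircle‖ := by
      refine le_trans ?_ (norm_eval_zero_le Q)
      refine (norm_contToLp_le p _).trans ?_
      rw [norm_smul, norm_star, fourier_norm, mul_one]
    have h2 := norm_add_le (contToLp p Q.toAddCircle) (contToLp p (star (Q.eval 0) • fourier 0))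
    have h3 : ‖(1 / 2 : ℂ)‖ = 1 / 2 := by norm_num
    rw [h3]
    linarith
  refine ⟨C, hC, fun Q hQ => ?_⟩
  -- Subtracting an imaginary constant makes `Q(0)` real without changing the real part.
  let Q' : Polynomial ℂ := Q - Polynomial.C (Complex.I * (Q.eval 0).im)
  have hre : ∀ t, (Q'.toAddCircle t).re = (Q.toAddCircle t).re := fun t => by
    simp [Q', Polynomial.toAddCircle_C_eq_smul_fourier_zero]
  have hre' : rePart Q.toAddCircle = rePart Q'.toAddCircle := by
    ext t
    simp [rePart, hre]
  rw [hre']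
  exact key Q' (fun t => by rw [hre]; exact hQ t) (by simp [Q'])

theorem exists_rePart_toAddCircle_eq {g : C(𝕋, ℂ)}
    (hg : g ∈ Submodule.span ℂ (Set.range (fourier (T := 2 * Real.pi)))) :
    ∃ Q : Polynomial ℂ, rePart Q.toAddCircle = rePart g := by
  -- `rePart` is only real-linear, so the scalar is carried through the induction. For negative
  -- frequencies `Re (c χ_{-n}) = Re (c̄ χ_n)`.
  suffices h : ∀ c : ℂ, ∃ Q : Polynomial ℂ, rePart Q.toAddCircle = rePart (c • g) by
    simpa using h 1
  induction hg using Submodule.span_induction with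
  | mem x hx =>
    obtain ⟨n, rfl⟩ := hx
    intro c
    rcases le_or_gt 0 n with hn | hn
    · refine ⟨Polynomial.monomial n.natAbs c, ?_⟩
      rw [Polynomial.toAddCircle_monomial_eq_smul_fourier, Int.natAbs_of_nonneg hn]
    · refine ⟨Polynomial.monomial n.natAbs (star c), ?_⟩
      rw [Polynomial.toAddCircle_monomial_eq_smul_fourier, Int.ofNat_natAbs_of_nonpos hn.le]
      ext t
      simp only [rePart, ContinuousMap.coe_mk, ContinuousMap.smul_apply, fourier_neg, smul_eq_mul]
      simp
  | zero => exact fun c => ⟨0, by simp⟩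
  | add x y _ _ hx hy =>
    intro c
    obtain ⟨P, hP⟩ := hx c
    obtain ⟨Q, hQ⟩ := hy c
    exact ⟨P + Q, by rw [map_add, rePart_add, hP, hQ, smul_add, rePart_add]⟩
  | smul a x _ hx =>
    intro c
    rw [smul_smul]
    exact hx _

theorem exists_norm_rePart_toAddCircle_sub_lt (g : C(𝕋, ℂ)) {ε : ℝ} (hε : 0 < ε) :
    ∃ Q : Polynomial ℂ, ‖rePart Q.toAddCircle - rePart g‖ < ε := by
  have hg : g ∈ closure
      (Submodule.span ℂ (Set.range (fourier (T := 2 * Real.pi))) : Set C(𝕋, ℂ)) := by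
    rw [← Submodule.topologicalClosure_coe, span_fourier_closure_eq_top]
    trivial
  obtain ⟨k, hk, hgk⟩ := Metric.mem_closure_iff.1 hg ε hε
  obtain ⟨Q, hQ⟩ := exists_rePart_toAddCircle_eq hk
  refine ⟨Q, ?_⟩
  rw [dist_comm, dist_eq_norm] at hgk
  rw [hQ]
  refine lt_of_le_of_lt ((ContinuousMap.norm_le _ (norm_nonneg _)).2 fun t => ?_) hgk
  refine le_trans ?_ ((k - g).norm_coe_le_norm t)
  have : (rePart k - rePart g) t = (((k - g) t).re : ℂ) := by simp [rePart]
  rw [this, Complex.norm_real]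
  exact Complex.abs_re_le_norm _

/-- The positive part of the real part of a continuous function. -/
def posRePart (f : C(𝕋, ℂ)) : C(𝕋, ℂ) := ⟨fun t => ((max (f t).re 0 : ℝ) : ℂ), by fun_prop⟩

theorem posRePart_decomposition (f : C(𝕋, ℂ)) :
    f = (posRePart f - posRePart (-f)) +
      Complex.I • (posRePart (-Complex.I • f) - posRePart (Complex.I • f)) := by
  have h : ∀ x : ℝ, ((max x 0 : ℝ) : ℂ) - ((max (-x) 0 : ℝ) : ℂ) = x := fun x => by
    rw [← Complex.ofReal_sub, max_zero_sub_max_neg_zero_eq_self]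
  ext t
  have h1 := h (f t).re
  have h2 := h (f t).im
  simp only [posRePart, ContinuousMap.add_apply, ContinuousMap.sub_apply, ContinuousMap.coe_mk,
    ContinuousMap.smul_apply, ContinuousMap.neg_apply, smul_eq_mul, Complex.neg_re,
    Complex.mul_re, Complex.I_re, Complex.I_im, zero_mul, one_mul,
    zero_sub, neg_mul, neg_neg]
  rw [h1, h2, mul_comm Complex.I, Complex.re_add_im]

theorem norm_contToLp_posRePart_le (f : C(𝕋, ℂ)) :
    ‖contToLp p (posRePart f)‖ ≤ ‖contToLp p f‖ := by
  refine norm_contToLp_mono p fun t => ?_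
  simp only [posRePart, ContinuousMap.coe_mk, Complex.norm_real]
  rw [Real.norm_of_nonneg (le_max_right _ _)]
  exact max_le (Complex.re_le_norm _) (norm_nonneg _)

theorem norm_contToLp_smul_of_norm_eq_one {c : ℂ} (hc : ‖c‖ = 1) (f : C(𝕋, ℂ)) :
    ‖contToLp p (c • f)‖ = ‖contToLp p f‖ := by
  rw [map_smul, norm_smul, hc, one_mul]

/-- The M. Riesz inequality for `1 < p ≤ 2`. -/
theorem exists_norm_analyticPart_le (hp1 : 1 < p) (hp2 : p ≤ 2) :
    ∃ C : ℝ, 0 ≤ C ∧ ∀ f : C(𝕋, ℂ), ‖analyticPart hp2 f‖ ≤ C * ‖contToLp p f‖ := by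
  obtain ⟨C, hC, h⟩ := norm_analyticPart_rePart_toAddCircle_le hp1 hp2
  have hpos : ∀ f : C(𝕋, ℂ),
      ‖analyticPart hp2 (posRePart f)‖ ≤ C * ‖contToLp p f‖ := by
    intro f
    refine le_trans ?_ (mul_le_mul_of_nonneg_left (norm_contToLp_posRePart_le f) hC)
    have hcl : IsClosed {g : C(𝕋, ℂ) | ‖analyticPart hp2 g‖ ≤ C * ‖contToLp p g‖} :=
      isClosed_le (by fun_prop) (by fun_prop)
    refine hcl.closure_subset (Metric.mem_closure_iff.2 fun ε hε => ?_)
    -- Lifting by `ε / 2` keeps real parts strictly positive for every approximant within `ε / 2`.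
    let k : C(𝕋, ℂ) := posRePart f + ContinuousMap.const 𝕋 ((ε / 2 : ℝ) : ℂ)
    have hk : rePart k = k := by
      ext t
      simp [k, rePart, posRePart]
    obtain ⟨Q, hQ⟩ := exists_norm_rePart_toAddCircle_sub_lt k (half_pos hε)
    rw [hk] at hQ
    refine ⟨rePart Q.toAddCircle, h Q fun t => ?_, ?_⟩
    · have h1 := ((rePart Q.toAddCircle - k).norm_coe_le_norm t).trans_lt hQ
      have h2 : (rePart Q.toAddCircle - k) t =
          (((Q.toAddCircle t).re - (max (f t).re 0 + ε / 2) : ℝ) : ℂ) := by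
        simp [k, rePart, posRePart]
      rw [h2, Complex.norm_real, Real.norm_eq_abs, abs_lt] at h1
      linarith [h1.1, le_max_right (f t).re 0]
    · have h3 : ‖k - posRePart f‖ ≤ ε / 2 := by
        refine (ContinuousMap.norm_le _ (by positivity)).2 fun t => ?_
        simp only [k, add_sub_cancel_left, ContinuousMap.const_apply, Complex.norm_real]
        rw [Real.norm_of_nonneg (by positivity)]
      rw [dist_comm, dist_eq_norm, ← sub_add_sub_cancel _ k]
      exact (norm_add_le _ _).trans_lt (by linarith)
  -- One `C` for each of the four positive parts of `f`.
  refine ⟨4 * C, by positivity, fun f => ?_⟩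
  have h1 := hpos f
  have h2 := hpos (-f)
  have h3 := hpos (-Complex.I • f)
  have h4 := hpos (Complex.I • f)
  rw [norm_contToLp_smul_of_norm_eq_one (by simp)] at h3 h4
  rw [map_neg, norm_neg] at h2
  have hf := congrArg (analyticPart hp2) (posRePart_decomposition f)
  rw [map_add, map_sub, map_smul, map_sub] at hf
  rw [hf]
  refine (norm_add_le _ _).trans ?_
  rw [norm_smul, Complex.norm_I, one_mul]
  refine (add_le_add (norm_sub_le _ _) (norm_sub_le _ _)).trans ?_
  linarith

/-! ### Duality: the range `p ≥ 2` -/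

/-- The trigonometric polynomial with given coefficients. -/
def trigPoly : (ℤ →₀ ℂ) →ₗ[ℂ] C(𝕋, ℂ) :=
  Finsupp.linearCombination ℂ fun n => fourier n

/-- The analytic part of the trigonometric polynomial with given coefficients. -/
def analyticTrigPoly : (ℤ →₀ ℂ) →ₗ[ℂ] C(𝕋, ℂ) :=
  Finsupp.linearCombination ℂ fun n => if 0 ≤ n then fourier n else 0

theorem trigPoly_single (n : ℤ) (c : ℂ) : trigPoly (Finsupp.single n c) = c • fourier n :=
  Finsupp.linearCombination_single ..

theorem analyticTrigPoly_single (n : ℤ) (c : ℂ) :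
    analyticTrigPoly (Finsupp.single n c) = c • if 0 ≤ n then fourier n else 0 :=
  Finsupp.linearCombination_single ..

theorem hardyProj_trigPoly (c : ℤ →₀ ℂ) :
    hardyProj (contToLp 2 (trigPoly c)) = contToLp 2 (analyticTrigPoly c) := by
  induction c using Finsupp.induction_linear with
  | zero => simp
  | add f g hf hg => rw [map_add, map_add, map_add, map_add, map_add, hf, hg]
  | single n c =>
    rw [trigPoly_single, analyticTrigPoly_single, map_smul, map_smul, map_smul]
    refine congrArg (c • ·) ((hardyProj_fourierLp n).trans ?_)
    split_ifs
    · rfl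
    · exact (map_zero _).symm

theorem integral_norm_mul_norm_le {p q : ℝ≥0∞} [ENNReal.HolderConjugate p q]
    (F : LpT p) (G : LpT q) : ∫ t, ‖F t‖ * ‖G t‖ ∂haarAddCircle ≤ ‖F‖ * ‖G‖ := by
  have h := (ContinuousLinearMap.mul ℂ ℂ).norm_holder_apply_apply_le (r := 1) F G
  rw [L1.norm_eq_integral_norm] at h
  refine le_trans (le_of_eq ?_) (h.trans ?_)
  · refine integral_congr_ae ?_
    filter_upwards [(ContinuousLinearMap.mul ℂ ℂ).coeFn_holder (r := 1) F G] with t ht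
    rw [ht, ContinuousLinearMap.mul_apply', norm_mul]
  · simp

theorem norm_inner_le_of_holderConjugate {q : ℝ≥0∞} [Fact (1 ≤ q)] [ENNReal.HolderConjugate q p]
    (hq : q ≤ 2) (G : LpT 2) (f : C(𝕋, ℂ)) :
    ‖inner ℂ G (contToLp 2 f)‖ ≤ ‖lpIncl hq G‖ * ‖contToLp p f‖ := by
  rw [L2.inner_def]
  refine (norm_integral_le_integral_norm _).trans (le_trans (le_of_eq ?_)
    (integral_norm_mul_norm_le (lpIncl hq G) (contToLp p f)))
  refine integral_congr_ae ?_
  filter_upwards [coeFn_lpIncl hq G, coeFn_contToLp p f, coeFn_contToLp 2 f] with t h1 h2 h3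
  rw [h1, h2, h3]
  simp [mul_comm]

theorem exists_norm_analyticTrigPoly_le_of_le_two (hp1 : 1 < p) (hp2 : p ≤ 2) :
    ∃ C : ℝ, ∀ c : ℤ →₀ ℂ,
      ‖contToLp p (analyticTrigPoly c)‖ ≤ C * ‖contToLp p (trigPoly c)‖ := by
  obtain ⟨C, -, h⟩ := exists_norm_analyticPart_le hp1 hp2
  refine ⟨C, fun c => (le_of_eq ?_).trans (h (trigPoly c))⟩
  rw [analyticPart, ContinuousLinearMap.comp_apply, ContinuousLinearMap.comp_apply,
    hardyProj_trigPoly, lpIncl_contToLp]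

/-- The projection is self-adjoint on `L^2`, so with `k` the analytic part of `f` and `g` the
function dual to `k`, `‖k‖_p^p = ⟨g, k⟩ = ⟨Pg, f⟩`. Hölder and the bound for the conjugate exponent
`q ≤ 2` apply to the right side. -/
theorem exists_norm_analyticTrigPoly_le_of_two_le (hp : p ≠ ∞) (hp2 : 2 ≤ p) :
    ∃ C : ℝ, ∀ c : ℤ →₀ ℂ,
      ‖contToLp p (analyticTrigPoly c)‖ ≤ C * ‖contToLp p (trigPoly c)‖ := by
  set r := p.toReal with hr
  have hr2 : 2 ≤ r := by simpa using ENNReal.toReal_mono hp hp2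
  set s : ℝ := r / (r - 1) with hs
  have hsr : s.HolderConjugate r := (Real.HolderConjugate.conjExponent (by linarith)).symm
  have hs1 : 1 < s := hsr.lt
  have hs2 : s ≤ 2 := by
    rw [hs, div_le_iff₀ (by linarith)]
    linarith
  let q : ℝ≥0∞ := ENNReal.ofReal s
  have hq1 : 1 < q := by simpa [q] using hs1
  have hq2 : q ≤ 2 := by
    rw [← ENNReal.ofReal_ofNat]
    exact ENNReal.ofReal_le_ofReal hs2
  have hqs : q.toReal = s := ENNReal.toReal_ofReal (by linarith)
  have hqt : q ≠ ∞ := ENNReal.ofReal_ne_top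
  have : Fact (1 ≤ q) := ⟨hq1.le⟩
  have : ENNReal.HolderConjugate q p := by
    have := hsr.ennrealOfReal
    rwa [hr, ENNReal.ofReal_toReal hp] at this
  obtain ⟨C, hC, h⟩ := exists_norm_analyticPart_le hq1 hq2
  refine ⟨C, fun c => ?_⟩
  set k := analyticTrigPoly c with hk
  set f := trigPoly c with hf
  -- The Hölder extremal `|k|^{r-2} k`: it satisfies `|g|^s = |k|^r` and `ḡ k = |k|^r`.
  let g : C(𝕋, ℂ) := ⟨fun t => ((‖k t‖ ^ (r - 2) : ℝ) : ℂ) * k t, by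
    refine (Complex.continuous_ofReal.comp ?_).mul k.continuous
    exact k.continuous.norm.rpow_const fun t => Or.inr (by linarith)⟩
  have hgn : ∀ t, ‖g t‖ ^ s = ‖k t‖ ^ r := fun t => by
    have h1 : ‖g t‖ = ‖k t‖ ^ (r - 1) := by
      simp only [g, ContinuousMap.coe_mk, norm_mul, Complex.norm_real]
      rw [Real.norm_of_nonneg (by positivity)]
      nth_rewrite 2 [← Real.rpow_one ‖k t‖]
      rw [← Real.rpow_add_of_nonneg (norm_nonneg _) (by linarith) (by linarith)]
      ring_nf
    rw [h1, ← Real.rpow_mul (norm_nonneg _), hs, mul_div_cancel₀ _ (by linarith)]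
  set N : ℝ := ∫ t, ‖k t‖ ^ r ∂haarAddCircle with hN
  have hN0 : 0 ≤ N := integral_nonneg fun t => by positivity
  have hkN : ‖contToLp p k‖ = N ^ r⁻¹ := norm_contToLp hp k
  have hgN : ‖contToLp q g‖ = N ^ s⁻¹ := by
    rw [norm_contToLp hqt g, hqs]
    simp only [hgn, hN]
  have hinner : inner ℂ (contToLp 2 g) (contToLp 2 k) = (N : ℂ) := by
    rw [L2.inner_def, hN, ← integral_complex_ofReal]
    refine integral_congr_ae ?_
    filter_upwards [coeFn_contToLp 2 g, coeFn_contToLp 2 k] with t h1 h2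
    rw [h1, h2, RCLike.inner_apply]
    simp only [g, ContinuousMap.coe_mk, map_mul, Complex.conj_ofReal]
    rw [mul_left_comm, Complex.mul_conj, Complex.normSq_eq_norm_sq, ← Complex.ofReal_mul,
      ← Real.rpow_natCast, ← Real.rpow_add_of_nonneg (norm_nonneg _) (by linarith) (by norm_num)]
    norm_num
  have hmain : N ≤ C * N ^ s⁻¹ * ‖contToLp p f‖ := by
    have h1 : ‖inner ℂ (hardyProj (contToLp 2 g)) (contToLp 2 f)‖ = N := by
      rw [inner_hardyProj, hf, hardyProj_trigPoly, hinner, Complex.norm_real,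
        Real.norm_of_nonneg hN0]
    rw [← hgN]
    refine h1.ge.trans ?_
    refine (norm_inner_le_of_holderConjugate (p := p) hq2 _ f).trans ?_
    exact mul_le_mul_of_nonneg_right (h g) (norm_nonneg _)
  rw [hkN]
  rcases hN0.eq_or_lt with hN' | hN'
  · rw [← hN', Real.zero_rpow (by positivity)]
    positivity
  · have h1 : N = N ^ s⁻¹ * N ^ r⁻¹ := by
      rw [← Real.rpow_add hN', hsr.inv_add_inv_eq_one, Real.rpow_one]
    have h2 : 0 < N ^ s⁻¹ := Real.rpow_pos_of_pos hN' _
    refine le_of_mul_le_mul_left ?_ h2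
    rw [← h1]
    linarith

/-! ### Construction of the Riesz projection -/

/-- The `n`-th Fourier coefficient as a bounded functional on `L^p`. -/
def fourierCoeffL (p : ℝ≥0∞) [Fact (1 ≤ p)] (n : ℤ) : LpT p →L[ℂ] ℂ :=
  L1.integralCLM' ℂ ∘L lpIncl (Fact.out : 1 ≤ p) ∘L shift p (-n)

theorem fourierCoeffL_apply (n : ℤ) (f : LpT p) :
    fourierCoeffL p n f = fourierCoeff (f : 𝕋 → ℂ) n := by
  change L1.integralCLM' ℂ (lpIncl (Fact.out : 1 ≤ p) (shift p (-n) f)) = _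
  rw [← L1.integral_eq', L1.integral_eq_integral, fourierCoeff]
  refine integral_congr_ae ?_
  filter_upwards [coeFn_lpIncl (Fact.out : 1 ≤ p) (shift p (-n) f), coeFn_shift (-n) f]
    with t h1 h2
  rw [h1, h2, smul_eq_mul]

theorem exists_isRieszProjection (hp : p ≠ ∞)
    (h : ∃ C : ℝ, ∀ c : ℤ →₀ ℂ,
      ‖contToLp p (analyticTrigPoly c)‖ ≤ C * ‖contToLp p (trigPoly c)‖) :
    ∃ P : LpT p →L[ℂ] LpT p, IsRieszProjection P := by
  let A : (ℤ →₀ ℂ) →ₗ[ℂ] LpT p := (contToLp p).toLinearMap ∘ₗ analyticTrigPoly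
  let T : (ℤ →₀ ℂ) →ₗ[ℂ] LpT p := (contToLp p).toLinearMap ∘ₗ trigPoly
  have hdense : Dense (Submodule.span ℂ (Set.range (fourierLp (T := 2 * Real.pi) p)) :
      Set (LpT p)) := by
    rw [Submodule.dense_iff_topologicalClosure_eq_top]
    exact span_fourierLp_closure_eq_top hp
  have hT : ∀ n, T (Finsupp.single n 1) = fourierLp p n := fun n => by
    change contToLp p (trigPoly _) = _
    rw [trigPoly_single, one_smul]
  have hA : ∀ n, A (Finsupp.single n 1) = if 0 ≤ n then fourierLp p n else 0 := fun n => by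
    change contToLp p (analyticTrigPoly _) = _
    rw [analyticTrigPoly_single, one_smul]
    split_ifs
    · rfl
    · exact map_zero _
  have hrange : DenseRange T := by
    refine hdense.mono ?_
    rw [← LinearMap.coe_range, SetLike.coe_subset_coe, Submodule.span_le]
    rintro _ ⟨n, rfl⟩
    exact ⟨_, hT n⟩
  let P : LpT p →L[ℂ] LpT p := A.extendOfNorm T
  have hP : ∀ n, P (fourierLp p n) = if 0 ≤ n then fourierLp p n else 0 := fun n => by
    rw [← hA n, ← hT n]
    exact LinearMap.extendOfNorm_eq hrange h _
  refine ⟨P, fun f n => ?_⟩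
  -- Both sides are bounded functionals, so agreement on the characters suffices.
  have key : fourierCoeffL p n ∘L P = if 0 ≤ n then fourierCoeffL p n else 0 := by
    refine ContinuousLinearMap.ext_on hdense ?_
    rintro _ ⟨k, rfl⟩
    rw [ContinuousLinearMap.comp_apply, hP]
    split_ifs with h1 h2 h2
    · rfl
    · rw [fourierCoeffL_apply, fourierCoeff_fourierLp, if_neg (by lia)]
      rfl
    · rw [fourierCoeffL_apply, fourierCoeffL_apply, fourierCoeff_fourierLp, if_neg (by lia),
        ← fourierCoeffL_apply, map_zero]
    · rw [map_zero]
      rfl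
  have := DFunLike.congr_fun key f
  rw [ContinuousLinearMap.comp_apply, fourierCoeffL_apply] at this
  rw [this]
  split_ifs
  · exact fourierCoeffL_apply n f
  · rfl

/-- The M. Riesz theorem: the Riesz projection is bounded on `L^p` for `1 < p < ∞`. -/
theorem isRieszProjection_rieszProjection (hp1 : 1 < p) (hp : p ≠ ∞) :
    IsRieszProjection (rieszProjection p) := by
  have h : ∃ P : LpT p →L[ℂ] LpT p, IsRieszProjection P :=
    exists_isRieszProjection hp ((le_total p 2).elim
      (exists_norm_analyticTrigPoly_le_of_le_two hp1)
      (exists_norm_analyticTrigPoly_le_of_two_le hp))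
  rw [rieszProjection, dif_pos h]
  exact h.choose_spec

end

end HardyToeplitz

/-! ### The two-sided estimate -/

open HardyToeplitz in
theorem mainTheorem7 (p : ℝ≥0∞) [Fact (1 ≤ p)] (hp1 : 1 < p) (hp : p < ∞) :
    IsRieszProjection (rieszProjection p) ∧
    ∀ (a b : LpT ∞) (K : Hp p →L[ℂ] Hp p), IsCompactOperator K →
      max ‖a‖ (1 / (1 + ‖rieszProjection p‖) * ‖hankel p b + K‖)
          ≤ ‖toeplitz p a + hankel p b + K‖ ∧
      ‖toeplitz p a + hankel p b + K‖
          ≤ ‖rieszProjection p‖ * ‖a‖ + ‖hankel p b + K‖ := by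
  have hR := isRieszProjection_rieszProjection hp1 hp.ne
  refine ⟨hR, fun a b K hK => ?_⟩
  have ha : ‖a‖ ≤ ‖toeplitz p a + hankel p b + K‖ :=
    norm_le_of_norm_mulOp_le (norm_nonneg (toeplitz p a + hankel p b + K))
      (norm_mulOp_apply_le_of_isCompactOperator hR hp.ne a b hK)
  have hT := norm_toeplitz_le (p := p) a
  refine ⟨max_le ha ?_, ?_⟩
  · rw [one_div, inv_mul_le_iff₀ (by positivity)]
    have h1 := norm_sub_le (toeplitz p a + hankel p b + K) (toeplitz p a)
    rw [add_assoc, add_sub_cancel_left, ← add_assoc] at h1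
    have h2 := mul_le_mul_of_nonneg_left ha (norm_nonneg (rieszProjection p))
    linarith
  · rw [add_assoc]
    have h1 := norm_add_le (toeplitz p a) (hankel p b + K)
    linarith
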